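/- Let $r>2$ and let $(W,S)$ be a Coxeter system of type $A_r$, with $W=\langle s\in S\mid (ss')^{m(s,s')}=1\rangle$. Let $V$ be the complex vector space with basis $\{\alpha_s\}_{s\in S}$ and bilinear form $B(\alpha_s,\alpha_{s'})=-\cos\frac{\pi}{m(s,s')}$. Let $\rho_{ref}:W\to GL(V)$ be the standard reflection representation, $\rho_{ref}(s)v=v-2B(\alpha_s,v)\alpha_s$ for $s\in S$, let $\rho_{sign}:W\to\mathbb C^*$ be the sign representation, sending each $s\in S$ to $-1$, and let $\rho_{new}=\rho_{sign}\otimes\rho_{ref}:W\to GL(\mathbb C\otimes V)$. Then $\rho_{new}$ is irreducible, and it is not a reflection representation: the group $\rho_{new}(W)$ is not generated by the (pseudo-)reflections it contains, where a (pseudo-)reflection is a linear automorphism $g$ of finite order such that $g-1$ has rank one. Moreover the ring $\mathbb C[\rho_{new}]$ of $\rho_{new}(W)$-invariant polynomial functions on $\mathbb C\otimes V$ is not a polynomial ring, that is, it is not isomorphic as a $\mathbb C$-algebra to a polynomial ring $\mathbb C[x_i : i\in I]$ for any set $I$ of variables. -/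

import Mathlib

noncomputable section

namespace CoxeterRep

open scoped TensorProduct

/-- The standard bilinear form of a Coxeter matrix `M` on the space with basis `α_s`
(`α_s = Pi.single s 1`), determined by `B(α_s, α_t) = -cos(π / M s t)`. -/
def form {r : ℕ} (M : CoxeterMatrix (Fin r)) : LinearMap.BilinForm ℂ (Fin r → ℂ) :=
  Matrix.toBilin' (Matrix.of fun s t => ((-Real.cos (Real.pi / (M s t : ℝ)) : ℝ) : ℂ))

/-- The simple root `α_s`. -/
def root {r : ℕ} (s : Fin r) : Fin r → ℂ := Pi.single s 1

/-- The map `R_s : v ↦ v - 2 B(α_s, v) α_s`. -/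
def refl {r : ℕ} (M : CoxeterMatrix (Fin r)) (s : Fin r) : Module.End ℂ (Fin r → ℂ) :=
  LinearMap.id - ((2 : ℂ) • form M (root s)).smulRight (root s)

theorem refl_apply {r : ℕ} (M : CoxeterMatrix (Fin r)) (s : Fin r) (v : Fin r → ℂ) :
    refl M s v = v - (2 * form M (root s) v) • root s := by
  simp [refl]

theorem form_root {r : ℕ} (M : CoxeterMatrix (Fin r)) (s t : Fin r) :
    form M (root s) (root t) = ((-Real.cos (Real.pi / (M s t : ℝ)) : ℝ) : ℂ) := by
  simp [form, root, Matrix.toBilin'_single]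

theorem form_root_self {r : ℕ} (M : CoxeterMatrix (Fin r)) (s : Fin r) :
    form M (root s) (root s) = 1 := by
  simp [form_root]

theorem A_cases {r : ℕ} (s t : Fin r) :
    (s = t) ∨ CoxeterMatrix.A r s t = 2 ∨ CoxeterMatrix.A r s t = 3 := by
  by_cases h : s = t
  · exact Or.inl h
  · right
    simp only [CoxeterMatrix.A, Matrix.of_apply, if_neg h]
    split_ifs <;> simp

/-- The maps `R_s` satisfy the Coxeter relations of type `A_r`. -/
theorem refl_isLiftable (r : ℕ) :
    (CoxeterMatrix.A r).IsLiftable (refl (CoxeterMatrix.A r)) := by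
  intro s t
  have hs := form_root_self (CoxeterMatrix.A r) s
  have ht := form_root_self (CoxeterMatrix.A r) t
  have hst := form_root (CoxeterMatrix.A r) s t
  have hts := form_root (CoxeterMatrix.A r) t s
  rw [(CoxeterMatrix.A r).symmetric t s] at hts
  refine LinearMap.ext fun v => ?_
  rcases A_cases s t with rfl | h | h
  · rw [(CoxeterMatrix.A r).diagonal]
    simp only [pow_one, Module.End.mul_apply, Module.End.one_apply, refl_apply, map_sub, map_smul,
      smul_eq_mul, hs]
    module
  · rw [h] at hst hts ⊢
    simp only [Nat.cast_ofNat, Real.cos_pi_div_two, neg_zero, Complex.ofReal_zero] at hst hts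
    simp only [pow_succ, pow_zero, one_mul, Module.End.mul_apply, Module.End.one_apply, refl_apply,
      map_sub, map_smul, smul_eq_mul, hs, ht, hst, hts]
    module
  · rw [h] at hst hts ⊢
    have e : ((-Real.cos (Real.pi / ((3 : ℕ) : ℝ)) : ℝ) : ℂ) = -(1 / 2) := by
      rw [Nat.cast_ofNat, Real.cos_pi_div_three]; push_cast; ring
    rw [e] at hst hts
    simp only [pow_succ, pow_zero, one_mul, Module.End.mul_apply, Module.End.one_apply, refl_apply,
      map_sub, map_smul, smul_eq_mul, hs, ht, hst, hts]
    module

section Representations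

variable {r : ℕ} {W : Type*} [Group W]

/-- The standard reflection representation `s ↦ R_s` of a Coxeter group of type `A_r`. -/
def refRep (cs : CoxeterSystem (CoxeterMatrix.A r) W) : Representation ℂ W (Fin r → ℂ) :=
  cs.lift ⟨refl (CoxeterMatrix.A r), refl_isLiftable r⟩

/-- The sign representation, sending every simple generator to multiplication by `-1`. -/
def signRep (cs : CoxeterSystem (CoxeterMatrix.A r) W) : Representation ℂ W ℂ :=
  cs.lift ⟨fun _ => (-1 : Module.End ℂ ℂ), fun _ _ => by simp⟩

/-- The representation `ρ_new = ρ_sign ⊗ ρ_ref` on `ℂ ⊗ V`. -/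
def newRep (cs : CoxeterSystem (CoxeterMatrix.A r) W) :
    Representation ℂ W (ℂ ⊗[ℂ] (Fin r → ℂ)) :=
  (signRep cs).tprod (refRep cs)

end Representations

section General

variable {G V : Type*} [Group G] [AddCommGroup V] [Module ℂ V]

/-- A (pseudo-)reflection of a complex vector space: an automorphism of finite order whose fixed
subspace is a hyperplane, i.e. `g - 1` has rank one. -/
def IsReflection (g : LinearMap.GeneralLinearGroup ℂ V) : Prop :=
  IsOfFinOrder g ∧ Module.finrank ℂ (LinearMap.range ((g : V →ₗ[ℂ] V) - 1)) = 1

/-- The image `ψ(G)` is generated, as a group, by the reflections that it contains. -/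
def IsReflectionRep (ψ : Representation ℂ G V) : Prop :=
  Subgroup.closure {g | g ∈ ψ.asGroupHom.range ∧ IsReflection g} = ψ.asGroupHom.range

variable (V) in
/-- `ℂ[V]`, the algebra of polynomial functions on `V`: the subalgebra of all functions on `V`
generated by the linear forms. -/
def polyFun : Subalgebra ℂ (V → ℂ) :=
  Algebra.adjoin ℂ (Set.range fun φ : Module.Dual ℂ V => (φ : V → ℂ))

/-- `ℂ[ψ]`, the algebra of polynomial functions on `V` invariant under `ψ`. -/
def invariantRing (ψ : Representation ℂ G V) : Subalgebra ℂ (V → ℂ) where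
  carrier := {f | f ∈ polyFun V ∧ ∀ (g : G) (v : V), f (ψ g v) = f v}
  mul_mem' := fun ha hb => ⟨mul_mem ha.1 hb.1, fun g v => by simp [ha.2 g v, hb.2 g v]⟩
  add_mem' := fun ha hb => ⟨add_mem ha.1 hb.1, fun g v => by simp [ha.2 g v, hb.2 g v]⟩
  algebraMap_mem' := fun c => ⟨Subalgebra.algebraMap_mem _ c, fun _ _ => rfl⟩

end General

/-- A `ℂ`-algebra is a polynomial ring if it is isomorphic to `ℂ[x_i : i ∈ σ]` for some set `σ` of
variables. -/
def IsPolynomialRing (A : Type*) [CommRing A] [Algebra ℂ A] : Prop :=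
  ∃ σ : Type, Nonempty (A ≃ₐ[ℂ] MvPolynomial σ ℂ)

end CoxeterRep

end

/-!
Through `α_s ↦ e_s - e_{s+1}`, the group `W` acts on the hyperplane `∑ y_i = 0` of `ℂ^{r+1}` by
permuting the coordinates; `ρ_new` twists this action by the sign of the permutation.

If `ρ_new(w)` is a pseudo-reflection, then a vector which `ρ_new(w) - 1` sends into the kernel of a
linear form not vanishing on the range of `ρ_new(w) - 1` is fixed. For `r > 2` there are, for each
`w`, explicit vectors contradicting this, so that `ρ_new(W)` contains no reflection at all.

For the invariants, let `f` and `h` be coprime polynomial functions, each multiplied by the sign of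
`w` under every `w`. Then `f² h² = (f h)²` in the ring of invariants. If that ring were factorial,
there would be invariants `a, b, c` with `f² = c a²` and `h² = c b²`. Coprimality makes `c` a
constant, so `f` is a constant multiple of `a`, hence invariant, which is absurd. A suitable pair is
`f = ∑ y_i³`, which changes sign because `3` is odd, and a Vandermonde product for `h`.
-/

noncomputable section

namespace CoxeterRep

open scoped TensorProduct

section LinearAlgebra

variable {K V : Type*} [Field K] [AddCommGroup V] [Module K V]

theorem exists_basis_coord_eq [FiniteDimensional K V] {φ : Module.Dual K V} (hφ : φ ≠ 0) :
    ∃ (n : ℕ) (b : Module.Basis (Fin (n + 1)) K V), b.coord 0 = φ := by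
  obtain ⟨u, hu⟩ := LinearMap.surjective hφ 1
  let b₀ := Module.finBasis K (LinearMap.ker φ)
  let b := Module.Basis.mkFinCons u b₀
    (fun c x hx h => by simpa [hu, LinearMap.mem_ker.mp hx] using congrArg φ h)
    (fun v => ⟨-φ v, by simp [hu]⟩)
  have hb : (b : Fin _ → V) = Fin.cons u (Subtype.val ∘ b₀) := Module.Basis.coe_mkFinCons ..
  refine ⟨_, b, b.ext fun i => ?_⟩
  rw [b.coord_apply, b.repr_self, hb]
  cases i using Fin.cases with
  | zero => simp [hu]
  | succ j => simp

theorem map_eq_zero_of_finrank_range_eq_one {V' : Type*} [AddCommGroup V']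
    [Module K V'] {T : V →ₗ[K] V'}
    (hT : Module.finrank K (LinearMap.range T) = 1) {φ : Module.Dual K V'} {x y : V}
    (hx : φ (T x) ≠ 0) (hy : φ (T y) = 0) : T y = 0 := by
  have hx' : T.rangeRestrict x ≠ 0 := fun h => hx (by
    rw [show T x = 0 from congrArg Subtype.val h, map_zero])
  obtain ⟨c, hc⟩ := exists_smul_eq_of_finrank_eq_one hT hx' (T.rangeRestrict y)
  have hTy : T y = c • T x := (congrArg Subtype.val hc).symm
  have hc₀ : c = 0 := by simpa [hTy, hx] using hy
  rw [hTy, hc₀, zero_smul]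

end LinearAlgebra

section Permutations

theorem eq_of_forall_castSucc_eq_succ {n : ℕ} {α : Sort*} {f : Fin (n + 1) → α}
    (h : ∀ i : Fin n, f i.castSucc = f i.succ) (i j : Fin (n + 1)) : f i = f j := by
  have h₀ : ∀ i, f i = f 0 := by
    intro i
    induction i using Fin.induction with
    | zero => rfl
    | succ i ih => rw [← h, ih]
  rw [h₀ i, h₀ j]

theorem exists_apply_ne_of_sign_eq_one {α : Type*} [Fintype α] [DecidableEq α]
    {σ : Equiv.Perm α} (hσ : σ.sign = 1) (hne : σ ≠ 1) :
    ∃ i j, σ i ≠ i ∧ σ j ≠ j ∧ j ≠ i ∧ j ≠ σ i := by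
  obtain ⟨i, hi⟩ := DFunLike.ne_iff.mp hne
  by_contra! h
  have hsupp : σ.support ⊆ {i, σ i} := fun j hj => by
    by_cases hji : j = i
    · simp [hji]
    · simp [h i j hi (Equiv.Perm.mem_support.mp hj) hji]
  have hcard : σ.support.card = 2 := le_antisymm
    ((Finset.card_le_card hsupp).trans Finset.card_le_two)
    (Equiv.Perm.two_le_card_support_of_ne_one hne)
  have hswap := (Equiv.Perm.card_support_eq_two.mp hcard).sign_eq
  exact absurd (hσ.symm.trans hswap) (by decide)

theorem exists_notMem_of_card_lt {α : Type*} [Fintype α] {s : Finset α}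
    (hs : s.card < Fintype.card α) : ∃ a, a ∉ s := by
  obtain ⟨a, -, ha⟩ := Finset.exists_mem_notMem_of_card_lt_card hs
  exact ⟨a, ha⟩

theorem exists_disjoint_of_sign_eq_neg_one {n : ℕ} (hn : 3 < n) {σ : Equiv.Perm (Fin n)}
    (hσ : σ.sign = -1) :
    ∃ k l m, l ≠ k ∧ l ≠ σ k ∧ m ≠ k ∧ m ≠ σ k ∧ m ≠ l ∧ m ≠ σ l := by
  obtain rfl | hn : n = 4 ∨ 4 < n := by lia
  · revert σ
    decide
  · let k : Fin n := ⟨0, by lia⟩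
    obtain ⟨l, hl⟩ := exists_notMem_of_card_lt (s := {k, σ k})
      (Finset.card_le_two.trans_lt (by rw [Fintype.card_fin]; lia))
    obtain ⟨m, hm⟩ := exists_notMem_of_card_lt (s := {k, σ k, l, σ l})
      (Finset.card_le_four.trans_lt (by rwa [Fintype.card_fin]))
    simp only [Finset.mem_insert, Finset.mem_singleton, not_or] at hl hm
    exact ⟨k, l, m, hl.1, hl.2, hm⟩

theorem isThreeCycle_swap_mul_swap {n : ℕ} {s t : Fin n} (h : s.succ = t.castSucc) :
    (Equiv.swap s.castSucc s.succ * Equiv.swap t.castSucc t.succ).IsThreeCycle := by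
  have hst : s.castSucc < t.castSucc := h ▸ Fin.castSucc_lt_succ
  rw [Equiv.swap_comm s.castSucc, h]
  exact Equiv.Perm.isThreeCycle_swap_mul_swap_same hst.ne' Fin.castSucc_lt_succ.ne
    (hst.trans Fin.castSucc_lt_succ).ne

theorem exists_embedding_zero_one {α : Type*} [Finite α] {n : ℕ} (hn : n + 2 ≤ Nat.card α)
    {i j : α} (hij : i ≠ j) : ∃ e : Fin (n + 2) ↪ α, e 0 = i ∧ e 1 = j := by
  obtain ⟨e, he⟩ := Fin.Embedding.restrictSurjective_of_le_natCard (Nat.le_add_left 2 n) hn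
    (Function.Embedding.embFinTwo hij)
  exact ⟨e, DFunLike.congr_fun he 0, DFunLike.congr_fun he 1⟩

theorem prod_prod_Ioi_const {M : Type*} [CommMonoid M] (n : ℕ) (c : M) :
    ∏ i : Fin n, ∏ _j ∈ Finset.Ioi i, c = c ^ n.choose 2 := by
  simp only [Finset.prod_const, Fin.card_Ioi, Finset.prod_pow_eq_pow_sum]
  rw [Fin.sum_univ_eq_sum_range fun i => n - 1 - i, Finset.sum_range_reflect fun i => i,
    Finset.sum_range_id, Nat.choose_two_right]

theorem prod_prod_Ioi_sub_comp_perm {R : Type*} [CommRing R] {n : ℕ} (a : Fin n → R)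
    (σ : Equiv.Perm (Fin n)) :
    ∏ i, ∏ j ∈ Finset.Ioi i, (a (σ j) - a (σ i)) =
      σ.sign * ∏ i, ∏ j ∈ Finset.Ioi i, (a j - a i) := by
  rw [← Matrix.det_vandermonde fun i => a (σ i), ← Matrix.det_vandermonde, ← Matrix.det_permute]
  rfl

end Permutations

section PolynomialFunctions

variable {V : Type*} [AddCommGroup V] [Module ℂ V]

variable (V) in
/-- Linear forms, viewed as polynomial functions. -/
def linearFun : Module.Dual ℂ V →ₗ[ℂ] polyFun V where
  toFun φ := ⟨φ, Algebra.subset_adjoin ⟨φ, rfl⟩⟩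
  map_add' _ _ := rfl
  map_smul' _ _ := rfl

@[simp]
theorem linearFun_apply (φ : Module.Dual ℂ V) (v : V) : (linearFun V φ : V → ℂ) v = φ v :=
  rfl

theorem range_aeval_coord {ι : Type*} [Finite ι] (b : Module.Basis ι ℂ V) :
    (MvPolynomial.aeval fun i => (b.coord i : V → ℂ)).range = polyFun V := by
  have := Fintype.ofFinite ι
  rw [← Algebra.adjoin_range_eq_range_aeval]
  refine le_antisymm (Algebra.adjoin_mono (Set.range_subset_iff.mpr fun i => ⟨_, rfl⟩))
    (Algebra.adjoin_le (Set.range_subset_iff.mpr fun φ => ?_))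
  have hφ : (φ : V → ℂ) = ∑ i, φ (b i) • (b.coord i : V → ℂ) := by
    conv_lhs => rw [← b.sum_dual_apply_smul_coord φ, LinearMap.coe_sum]
    rfl
  rw [hφ]
  exact sum_mem fun i _ => Subalgebra.smul_mem _ (Algebra.subset_adjoin (Set.mem_range_self i)) _

theorem aeval_coord_apply {ι : Type*} [Finite ι] (b : Module.Basis ι ℂ V)
    (p : MvPolynomial ι ℂ) (v : V) :
    MvPolynomial.aeval (fun i => (b.coord i : V → ℂ)) p v = MvPolynomial.eval (b.equivFun v) p := by
  induction p using MvPolynomial.induction_on with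
  | C a => simp
  | add p q hp hq => simp [hp, hq]
  | mul_X p i hp => simp [hp]

theorem aeval_coord_injective {ι : Type*} [Finite ι] (b : Module.Basis ι ℂ V) :
    Function.Injective (MvPolynomial.aeval (R := ℂ) fun i => (b.coord i : V → ℂ)) := by
  refine fun p q h => MvPolynomial.funext fun y => ?_
  simpa only [aeval_coord_apply, LinearEquiv.apply_symm_apply] using congrFun h (b.equivFun.symm y)

/-- A basis identifies the algebra of polynomial functions with a polynomial ring. -/
def polyFunEquiv {ι : Type*} [Finite ι] (b : Module.Basis ι ℂ V) :
    MvPolynomial ι ℂ ≃ₐ[ℂ] polyFun V :=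
  (AlgEquiv.ofInjective _ (aeval_coord_injective b)).trans
    (Subalgebra.equivOfEq _ _ (range_aeval_coord b))

theorem polyFunEquiv_X {ι : Type*} [Finite ι] (b : Module.Basis ι ℂ V) (i : ι) :
    polyFunEquiv b (MvPolynomial.X i) = linearFun V (b.coord i) :=
  Subtype.ext (MvPolynomial.aeval_X _ i)

variable [FiniteDimensional ℂ V]

instance : IsDomain (polyFun V) :=
  (polyFunEquiv (Module.finBasis ℂ V)).symm.toMulEquiv.isDomain _

instance : UniqueFactorizationMonoid (polyFun V) :=
  (polyFunEquiv (Module.finBasis ℂ V)).toMulEquiv.uniqueFactorizationMonoid inferInstance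

theorem exists_eq_algebraMap_of_isUnit {f : polyFun V} (hf : IsUnit f) :
    ∃ c : ℂ, f = algebraMap ℂ (polyFun V) c := by
  let e := polyFunEquiv (Module.finBasis ℂ V)
  obtain ⟨c, -, hc⟩ := MvPolynomial.isUnit_iff_eq_C_of_isReduced.mp (hf.map e.symm)
  exact ⟨c, by rw [← e.apply_symm_apply f, hc, ← MvPolynomial.algebraMap_eq, e.commutes]⟩

theorem irreducible_linearFun {φ : Module.Dual ℂ V} (hφ : φ ≠ 0) :
    Irreducible (linearFun V φ) := by
  obtain ⟨n, b, rfl⟩ := exists_basis_coord_eq hφ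
  rw [← polyFunEquiv_X, MulEquiv.irreducible_iff]
  exact MvPolynomial.X_prime.irreducible

theorem isRelPrime_linearFun {φ : Module.Dual ℂ V} (hφ : φ ≠ 0) {f : polyFun V} {v : V}
    (hv : φ v = 0) (hf : (f : V → ℂ) v ≠ 0) : IsRelPrime (linearFun V φ) f := by
  rw [(irreducible_linearFun hφ).isRelPrime_iff_not_dvd]
  rintro ⟨q, rfl⟩
  exact hf (by simp [hv])

end PolynomialFunctions

section SemiInvariants

theorem exists_eq_mul_sq_of_mul_eq_sq {R : Type*} [CommRing R] [IsDomain R]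
    [UniqueFactorizationMonoid R] {x y z : R} (hx : x ≠ 0) (h : x * y = z ^ 2) :
    ∃ c a b, x = c * a ^ 2 ∧ y = c * b ^ 2 := by
  obtain ⟨a, b, d, hab, rfl, rfl⟩ := UniqueFactorizationMonoid.exists_reduced_factors x hx z
  have hd : d ≠ 0 := left_ne_zero_of_mul hx
  have ha : a ≠ 0 := right_ne_zero_of_mul hx
  have hay : a * y = d * b ^ 2 := mul_left_cancel₀ hd (by linear_combination h)
  obtain ⟨c, rfl⟩ : a ∣ d := (hab.pow_right (n := 2)).dvd_of_dvd_mul_right ⟨y, hay.symm⟩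
  exact ⟨c, a, b, by ring, mul_left_cancel₀ ha (by linear_combination hay)⟩

theorem IsPolynomialRing.uniqueFactorizationMonoid {A : Type*} [CommRing A] [Algebra ℂ A]
    (h : IsPolynomialRing A) : UniqueFactorizationMonoid A := by
  obtain ⟨σ, ⟨e⟩⟩ := h
  exact e.symm.toMulEquiv.uniqueFactorizationMonoid inferInstance

variable {G V : Type*} [Group G] [AddCommGroup V] [Module ℂ V]

/-- `f` is a semi-invariant of the quadratic character `χ`: each `g` multiplies it by `χ g = ±1`. -/
def IsSemiInvariant (ψ : Representation ℂ G V) (χ : G →* ℤˣ) (f : V → ℂ) : Prop :=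
  ∀ g v, f (ψ g v) = χ g • f v

variable {ψ : Representation ℂ G V} {χ : G →* ℤˣ}

theorem IsSemiInvariant.mul_mem_invariantRing {f h : V → ℂ} (hf : IsSemiInvariant ψ χ f)
    (hh : IsSemiInvariant ψ χ h) (hfV : f ∈ polyFun V) (hhV : h ∈ polyFun V) :
    f * h ∈ invariantRing ψ :=
  ⟨mul_mem hfV hhV, fun g v => by
    rw [Pi.mul_apply, hf, hh, smul_mul_smul_comm, Int.units_mul_self, one_smul, Pi.mul_apply]⟩

theorem IsSemiInvariant.eq_zero_of_mem_invariantRing {f : V → ℂ} (hf : IsSemiInvariant ψ χ f)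
    (hχ : χ ≠ 1) (hinv : f ∈ invariantRing ψ) : f = 0 := by
  obtain ⟨g, hg⟩ := DFunLike.ne_iff.mp hχ
  have hg : χ g = -1 := Int.units_ne_iff_eq_neg.mp hg
  ext v
  have hneg : f v = -f v := by
    conv_lhs => rw [← hinv.2 g v, hf, hg, Units.neg_smul, one_smul]
  exact CharZero.eq_neg_self_iff.mp hneg

variable [FiniteDimensional ℂ V]

theorem mem_invariantRing_of_sq_eq_unit_mul_sq {f c a : polyFun V} (hc : IsUnit c)
    (ha : (a : V → ℂ) ∈ invariantRing ψ) (hf : f ^ 2 = c * a ^ 2) :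
    (f : V → ℂ) ∈ invariantRing ψ := by
  obtain ⟨u, rfl⟩ := exists_eq_algebraMap_of_isUnit hc
  obtain ⟨m, rfl⟩ := IsAlgClosed.exists_pow_nat_eq u two_pos
  have hma : ((m • a : polyFun V) : V → ℂ) ∈ invariantRing ψ := Subalgebra.smul_mem _ ha m
  have hsq : f ^ 2 = (m • a) ^ 2 := by rw [hf, Algebra.smul_def, mul_pow, map_pow]
  rcases sq_eq_sq_iff_eq_or_eq_neg.mp hsq with rfl | rfl
  · exact hma
  · exact neg_mem hma

theorem not_isPolynomialRing_of_isSemiInvariant (hχ : χ ≠ 1) {f h : polyFun V} (hf₀ : f ≠ 0)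
    (hf : IsSemiInvariant ψ χ f) (hh : IsSemiInvariant ψ χ h) (hfh : IsRelPrime f h) :
    ¬ IsPolynomialRing (invariantRing ψ) := by
  intro hpoly
  have := hpoly.uniqueFactorizationMonoid
  let incl : invariantRing ψ →ₐ[ℂ] polyFun V := Subalgebra.inclusion fun _ hp => hp.1
  have incl_injective : Function.Injective incl := Subalgebra.inclusion_injective _
  have : IsDomain (invariantRing ψ) := incl_injective.isDomain incl
  let x : invariantRing ψ := ⟨f * f, hf.mul_mem_invariantRing hf f.2 f.2⟩
  let y : invariantRing ψ := ⟨h * h, hh.mul_mem_invariantRing hh h.2 h.2⟩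
  let z : invariantRing ψ := ⟨f * h, hf.mul_mem_invariantRing hh f.2 h.2⟩
  have hxyz : x * y = z ^ 2 := by
    rw [sq]; exact Subtype.ext (mul_mul_mul_comm (f : V → ℂ) f h h)
  have hx : x ≠ 0 := fun hx => hf₀ (mul_self_eq_zero.mp ((congrArg incl hx).trans (map_zero incl)))
  obtain ⟨c, a, b, hxc, hyc⟩ := exists_eq_mul_sq_of_mul_eq_sq hx hxyz
  have hfc : f ^ 2 = incl c * incl a ^ 2 := by
    rw [← map_pow, ← map_mul, ← hxc, sq]; rfl
  have hhc : h ^ 2 = incl c * incl b ^ 2 := by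
    rw [← map_pow, ← map_mul, ← hyc, sq]; rfl
  have hc : IsUnit (incl c) := hfh.pow (Dvd.intro _ hfc.symm) (Dvd.intro _ hhc.symm)
  exact hf₀ (Subtype.ext (hf.eq_zero_of_mem_invariantRing hχ
    (mem_invariantRing_of_sq_eq_unit_mul_sq hc a.2 hfc)))

end SemiInvariants

section PermutationModel

variable {r : ℕ}

theorem A_apply (s t : Fin r) : CoxeterMatrix.A r s t =
    if s = t then 1 else if (t : ℕ) + 1 = s ∨ (s : ℕ) + 1 = t then 3 else 2 :=
  rfl

variable (r) in
/-- The embedding `α_s ↦ e_s - e_{s+1}` of the root space into the permutation module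
`ℂ^{r+1}`. -/
def permCoord : (Fin r → ℂ) →ₗ[ℂ] (Fin (r + 1) → ℂ) :=
  Fintype.linearCombination ℂ fun s => Pi.single s.castSucc 1 - Pi.single s.succ 1

theorem permCoord_root (s : Fin r) :
    permCoord r (root s) = Pi.single s.castSucc 1 - Pi.single s.succ 1 := by
  simp [permCoord, root]

theorem eq_sum_smul_root (v : Fin r → ℂ) : v = ∑ s, v s • root s := by
  ext t
  simp [root, Pi.single_apply]

theorem sum_permCoord (v : Fin r → ℂ) : ∑ i, permCoord r v i = 0 := by
  simp only [permCoord, Fintype.linearCombination_apply, Finset.sum_apply, Pi.smul_apply]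
  rw [Finset.sum_comm]
  simp [← Finset.mul_sum]

theorem single_zero_sub_single_mem_range_permCoord (i : Fin (r + 1)) :
    Pi.single 0 1 - Pi.single i 1 ∈ LinearMap.range (permCoord r) := by
  induction i using Fin.induction with
  | zero => simp
  | succ s hs => simpa using add_mem hs ⟨root s, permCoord_root s⟩

theorem exists_permCoord_eq {y : Fin (r + 1) → ℂ} (hy : ∑ i, y i = 0) :
    ∃ v, permCoord r v = y := by
  have hy' : y = ∑ i, (-y i) • (Pi.single 0 1 - Pi.single i 1 : Fin (r + 1) → ℂ) := by
    simp only [smul_sub, Finset.sum_sub_distrib, ← Finset.sum_smul, Finset.sum_neg_distrib, hy]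
    ext j
    simp [Pi.single_apply]
  rw [← LinearMap.mem_range, hy']
  exact sum_mem fun i _ => Submodule.smul_mem _ _ (single_zero_sub_single_mem_range_permCoord i)

theorem range_permCoord :
    LinearMap.range (permCoord r) = LinearMap.ker (∑ i, LinearMap.proj (φ := fun _ => ℂ) i) := by
  ext y
  simp only [LinearMap.mem_ker, LinearMap.mem_range, LinearMap.sum_apply, LinearMap.proj_apply]
  exact ⟨fun ⟨v, hv⟩ => hv ▸ sum_permCoord v, exists_permCoord_eq⟩

theorem permCoord_injective : Function.Injective (permCoord r) := by
  have hsum : (∑ i, LinearMap.proj i : Module.Dual ℂ (Fin (r + 1) → ℂ)) ≠ 0 := fun h => by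
    simpa using congrArg (fun φ => φ (Pi.single 0 1)) h
  have hrange := Module.Dual.finrank_ker_add_one_of_ne_zero hsum
  have hker := (permCoord r).finrank_range_add_finrank_ker
  rw [← range_permCoord] at hrange
  simp only [Module.finrank_fin_fun] at hrange hker
  rw [← LinearMap.ker_eq_bot, ← Submodule.finrank_eq_zero]
  lia

theorem two_mul_form_root_root (s t : Fin r) :
    2 * form (CoxeterMatrix.A r) (root s) (root t) =
      permCoord r (root t) s.castSucc - permCoord r (root t) s.succ := by
  have hcast : s.castSucc = t.succ ↔ (t : ℕ) + 1 = s := by simp [Fin.ext_iff, eq_comm]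
  have hsucc : s.succ = t.castSucc ↔ (s : ℕ) + 1 = t := by simp [Fin.ext_iff]
  simp only [form_root, A_apply, permCoord_root, Pi.sub_apply, Pi.single_apply, Fin.castSucc_inj,
    Fin.succ_inj, hcast, hsucc]
  split_ifs with h₁ h₂ h₃
  all_goals try lia
  all_goals norm_num

theorem two_mul_form_root (s : Fin r) (v : Fin r → ℂ) :
    2 * form (CoxeterMatrix.A r) (root s) v = permCoord r v s.castSucc - permCoord r v s.succ := by
  rw [eq_sum_smul_root v]
  simp only [map_sum, map_smul, Finset.sum_apply, Pi.smul_apply, smul_eq_mul, Finset.mul_sum,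
    ← Finset.sum_sub_distrib]
  exact Finset.sum_congr rfl fun t _ => by linear_combination v t * two_mul_form_root_root s t

theorem permCoord_refl (s : Fin r) (v : Fin r → ℂ) (i : Fin (r + 1)) :
    permCoord r (refl (CoxeterMatrix.A r) s v) i =
      permCoord r v (Equiv.swap s.castSucc s.succ i) := by
  have hne : s.castSucc ≠ s.succ := Fin.castSucc_lt_succ.ne
  rw [refl_apply, two_mul_form_root, map_sub, map_smul, permCoord_root]
  rcases eq_or_ne i s.castSucc with rfl | h₁
  · simp [hne]
  rcases eq_or_ne i s.succ with rfl | h₂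
  · simp [hne.symm]
  · simp [Equiv.swap_apply_of_ne_of_ne h₁ h₂, h₁, h₂]

theorem isLiftable_swap :
    (CoxeterMatrix.A r).IsLiftable fun s => Equiv.swap s.castSucc s.succ := by
  intro s t
  rw [A_apply]
  split_ifs with h h'
  · simp [h]
  · have hcycle : (Equiv.swap s.castSucc s.succ * Equiv.swap t.castSucc t.succ).IsThreeCycle := by
      rcases h' with h' | h'
      · simpa using (isThreeCycle_swap_mul_swap (s := t) (t := s) (Fin.ext h')).inv
      · exact isThreeCycle_swap_mul_swap (Fin.ext h')
    rw [← hcycle.orderOf, pow_orderOf_eq_one]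
  · have hcomm : Commute (Equiv.swap s.castSucc s.succ) (Equiv.swap t.castSucc t.succ) :=
      (Equiv.Perm.disjoint_swap_swap (by simp [Fin.ext_iff]; lia)).commute
    rw [hcomm.mul_pow, sq, sq, Equiv.swap_mul_self, Equiv.swap_mul_self, one_mul]

end PermutationModel

section NewRep

variable {r : ℕ} {W : Type*} [Group W] (cs : CoxeterSystem (CoxeterMatrix.A r) W)

/-- The action of a Coxeter group of type `A_r` on `r + 1` letters, in which the simple generators
act by the adjacent transpositions. -/
def permHom : W →* Equiv.Perm (Fin (r + 1)) :=
  cs.lift ⟨_, isLiftable_swap⟩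

theorem permHom_simple (s : Fin r) :
    permHom cs (cs.simple s) = Equiv.swap s.castSucc s.succ :=
  cs.lift_apply_simple _ s

theorem signRep_simple (s : Fin r) : signRep cs (cs.simple s) = -1 :=
  cs.lift_apply_simple _ s

theorem refRep_simple (s : Fin r) : refRep cs (cs.simple s) = refl (CoxeterMatrix.A r) s :=
  cs.lift_apply_simple _ s

variable (r) in
/-- The coordinates of `ℂ ⊗ V` in the permutation module `ℂ^{r+1}`. -/
def coord : (ℂ ⊗[ℂ] (Fin r → ℂ)) →ₗ[ℂ] (Fin (r + 1) → ℂ) :=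
  permCoord r ∘ₗ (TensorProduct.lid ℂ (Fin r → ℂ)).toLinearMap

theorem coord_injective : Function.Injective (coord r) :=
  permCoord_injective.comp (TensorProduct.lid ℂ (Fin r → ℂ)).injective

theorem sum_coord (x : ℂ ⊗[ℂ] (Fin r → ℂ)) : ∑ i, coord r x i = 0 :=
  sum_permCoord _

theorem coord_tmul_root (a : ℂ) (s : Fin r) :
    coord r (a ⊗ₜ root s) = a • (Pi.single s.castSucc 1 - Pi.single s.succ 1) := by
  simp only [coord, LinearMap.comp_apply, LinearEquiv.coe_coe, TensorProduct.lid_tmul, map_smul,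
    permCoord_root]

theorem exists_coord_eq {y : Fin (r + 1) → ℂ} (hy : ∑ i, y i = 0) : ∃ x, coord r x = y := by
  obtain ⟨v, rfl⟩ := exists_permCoord_eq hy
  exact ⟨1 ⊗ₜ v, by simp [coord]⟩

theorem exists_coord_eq_add_const (y : Fin (r + 1) → ℂ) :
    ∃ x c, ∀ i, coord r x i = y i + c := by
  have hr : (r : ℂ) + 1 ≠ 0 := Nat.cast_add_one_ne_zero r
  let mean := (∑ i, y i) / (r + 1)
  obtain ⟨x, hx⟩ := exists_coord_eq (y := fun i => y i + -mean) (by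
    simp [mean, Finset.sum_add_distrib, mul_div_cancel₀ _ hr])
  exact ⟨x, -mean, congrFun hx⟩

theorem coord_newRep_simple (s : Fin r) (x : ℂ ⊗[ℂ] (Fin r → ℂ)) (i : Fin (r + 1)) :
    coord r (newRep cs (cs.simple s) x) i = -coord r x (Equiv.swap s.castSucc s.succ i) := by
  induction x using TensorProduct.induction_on with
  | zero => simp
  | tmul a v => simp [newRep, coord, signRep_simple, refRep_simple, permCoord_refl]
  | add x y hx hy => simp only [map_add, Pi.add_apply, hx, hy, neg_add]

theorem coord_newRep (w : W) (x : ℂ ⊗[ℂ] (Fin r → ℂ)) (i : Fin (r + 1)) :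
    coord r (newRep cs w x) i = (permHom cs w).sign • coord r x ((permHom cs w)⁻¹ i) := by
  induction w using cs.simple_induction generalizing x i with
  | one => simp
  | simple s =>
    rw [coord_newRep_simple, permHom_simple, Equiv.Perm.sign_swap Fin.castSucc_lt_succ.ne,
      Units.neg_smul, one_smul, Equiv.swap_inv]
  | mul v w hv hw =>
    rw [map_mul, Module.End.mul_apply, hv, hw, smul_smul, ← Equiv.Perm.mul_apply, map_mul,
      map_mul, mul_inv_rev]

end NewRep

section Irreducible

variable {r : ℕ} {W : Type*} [Group W] {cs : CoxeterSystem (CoxeterMatrix.A r) W}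

theorem newRep_simple_add_self (s : Fin r) (x : ℂ ⊗[ℂ] (Fin r → ℂ)) :
    newRep cs (cs.simple s) x + x =
      (coord r x s.castSucc - coord r x s.succ) • ((1 : ℂ) ⊗ₜ[ℂ] root s) := by
  refine coord_injective (funext fun i => ?_)
  have hne : s.castSucc ≠ s.succ := Fin.castSucc_lt_succ.ne
  rw [map_add, Pi.add_apply, coord_newRep_simple, map_smul, coord_tmul_root, one_smul]
  rcases eq_or_ne i s.castSucc with rfl | h₁
  · simp [hne, neg_add_eq_sub]
  rcases eq_or_ne i s.succ with rfl | h₂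
  · simp [hne.symm, neg_add_eq_sub]
  · simp [Equiv.swap_apply_of_ne_of_ne h₁ h₂, h₁, h₂]

theorem exists_coord_castSucc_ne_succ {x : ℂ ⊗[ℂ] (Fin r → ℂ)} (hx : x ≠ 0) :
    ∃ s : Fin r, coord r x s.castSucc ≠ coord r x s.succ := by
  contrapose! hx
  have hconst : ∀ i j, coord r x i = coord r x j := eq_of_forall_castSucc_eq_succ hx
  refine coord_injective (funext fun i => ?_)
  have hsum : (r + 1 : ℂ) * coord r x i = 0 := by
    simpa [hconst _ i] using sum_coord x
  simpa [Nat.cast_add_one_ne_zero] using hsum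

variable {U : Subrepresentation (newRep cs)}

theorem tmul_root_mem {x : ℂ ⊗[ℂ] (Fin r → ℂ)} (hx : x ∈ U.toSubmodule) {s : Fin r}
    (hs : coord r x s.castSucc ≠ coord r x s.succ) : 1 ⊗ₜ[ℂ] root s ∈ U.toSubmodule := by
  have h := U.toSubmodule.add_mem (U.apply_mem_toSubmodule (cs.simple s) hx) hx
  rw [newRep_simple_add_self] at h
  exact (Submodule.smul_mem_iff _ (sub_ne_zero.mpr hs)).mp h

theorem tmul_root_mem_iff {s t : Fin r} (hst : s.succ = t.castSucc) :
    1 ⊗ₜ[ℂ] root s ∈ U.toSubmodule ↔ 1 ⊗ₜ[ℂ] root t ∈ U.toSubmodule := by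
  have hs : s.castSucc < t.castSucc := hst ▸ Fin.castSucc_lt_succ
  have ht : t.castSucc < t.succ := Fin.castSucc_lt_succ
  constructor <;> intro h <;> refine tmul_root_mem h ?_ <;>
    simp [coord_tmul_root, hst, hs.ne, hs.ne', ht.ne, ht.ne', (hs.trans ht).ne, (hs.trans ht).ne']

theorem eq_top_of_tmul_root_mem {s : Fin r} (hs : 1 ⊗ₜ[ℂ] root s ∈ U.toSubmodule) : U = ⊤ := by
  have hroot : ∀ t, 1 ⊗ₜ[ℂ] root t ∈ U.toSubmodule := by
    cases r with
    | zero => exact s.elim0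
    | succ k =>
      have hadj := eq_of_forall_castSucc_eq_succ (f := fun t => 1 ⊗ₜ[ℂ] root t ∈ U.toSubmodule)
        fun i => propext (tmul_root_mem_iff i.succ_castSucc)
      exact fun t => (hadj s t).mp hs
  refine Subrepresentation.toSubmodule_injective (Submodule.eq_top_iff'.mpr fun x => ?_)
  obtain ⟨v, rfl⟩ := (TensorProduct.lid ℂ (Fin r → ℂ)).symm.surjective x
  rw [TensorProduct.lid_symm_apply, eq_sum_smul_root v, TensorProduct.tmul_sum]
  refine sum_mem fun t _ => ?_
  rw [TensorProduct.tmul_smul]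
  exact Submodule.smul_mem _ _ (hroot t)

variable (cs) in
theorem newRep_isIrreducible (hr : 0 < r) : (newRep cs).IsIrreducible := by
  have : NeZero r := ⟨hr.ne'⟩
  have : Nontrivial (ℂ ⊗[ℂ] (Fin r → ℂ)) := (TensorProduct.lid ℂ (Fin r → ℂ)).nontrivial
  have : Nontrivial (Subrepresentation (newRep cs)) :=
    ⟨⊥, ⊤, fun h => bot_ne_top (congrArg Subrepresentation.toSubmodule h)⟩
  refine ⟨fun U => or_iff_not_imp_left.mpr fun hU => ?_⟩
  obtain ⟨x, hxU, hx⟩ := U.toSubmodule.exists_mem_ne_zero_of_ne_bot fun h =>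
    hU (Subrepresentation.toSubmodule_injective h)
  obtain ⟨s, hs⟩ := exists_coord_castSucc_ne_succ hx
  exact eq_top_of_tmul_root_mem (tmul_root_mem hxU hs)

end Irreducible

section Reflections

variable {r : ℕ} {W : Type*} [Group W] {cs : CoxeterSystem (CoxeterMatrix.A r) W} {w : W}

theorem finrank_range_newRep_sub_one_ne_one_of_coord {i j : Fin (r + 1)}
    {x y : ℂ ⊗[ℂ] (Fin r → ℂ)} (hx : coord r (newRep cs w x) i ≠ coord r x i)
    (hy : coord r (newRep cs w y) i = coord r y i)
    (hy' : coord r (newRep cs w y) j ≠ coord r y j) :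
    Module.finrank ℂ (LinearMap.range (newRep cs w - 1)) ≠ 1 := by
  intro h
  have hy₀ : (newRep cs w - 1) y = 0 :=
    map_eq_zero_of_finrank_range_eq_one h (φ := LinearMap.proj i ∘ₗ coord r) (x := x)
      (by simpa [sub_eq_zero] using hx) (by simpa [sub_eq_zero] using hy)
  exact hy' (by rw [sub_eq_zero.mp hy₀]; rfl)

theorem finrank_range_newRep_sub_one_ne_one_of_even (hsign : (permHom cs w).sign = 1) :
    Module.finrank ℂ (LinearMap.range (newRep cs w - 1)) ≠ 1 := by
  by_cases hw : permHom cs w = 1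
  · have hw' : newRep cs w = 1 := LinearMap.ext fun x => coord_injective (funext fun i => by
      simp [coord_newRep, hw])
    rw [hw', sub_self, LinearMap.range_zero, finrank_bot]
    exact zero_ne_one
  obtain ⟨i, j, hi, hj, hji, hjσ⟩ := exists_apply_ne_of_sign_eq_one (σ := (permHom cs w)⁻¹)
    (by rwa [Equiv.Perm.sign_inv]) (by rwa [Ne, inv_eq_one])
  obtain ⟨x, a, hx⟩ := exists_coord_eq_add_const (Pi.single i 1)
  obtain ⟨y, b, hy⟩ := exists_coord_eq_add_const (Pi.single j 1)
  refine finrank_range_newRep_sub_one_ne_one_of_coord (i := i) (j := j) (x := x) (y := y) ?_ ?_ ?_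
  all_goals simp [-Equiv.Perm.coe_inv, coord_newRep, hsign, hx, hy, hi, hj, hji.symm, hjσ.symm]

theorem finrank_range_newRep_sub_one_ne_one_of_odd (hr : 2 < r)
    (hsign : (permHom cs w).sign = -1) :
    Module.finrank ℂ (LinearMap.range (newRep cs w - 1)) ≠ 1 := by
  obtain ⟨k, l, m, hlk, hlσ, hmk, hmσ, hml, hmσl⟩ := exists_disjoint_of_sign_eq_neg_one
    (σ := (permHom cs w)⁻¹) (Nat.succ_lt_succ hr) (by rwa [Equiv.Perm.sign_inv])
  obtain ⟨x, hx⟩ := exists_coord_eq (y := Pi.single k 1 - Pi.single m 1) (by simp)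
  obtain ⟨y, hy⟩ := exists_coord_eq (y := Pi.single l 1 - Pi.single m 1) (by simp)
  have hne : ∀ i j : Fin (r + 1), -Pi.single (M := fun _ => ℂ) i 1 j ≠ 1 := by
    intro i j
    rw [Pi.single_apply]
    split_ifs <;> norm_num
  refine finrank_range_newRep_sub_one_ne_one_of_coord (i := k) (j := l) (x := x) (y := y) ?_ ?_ ?_
  all_goals simp [-Equiv.Perm.coe_inv, coord_newRep, hsign, hx, hy, hne, hlk.symm, hlσ.symm,
    hmk.symm, hmσ.symm, hml.symm, hmσl.symm]

variable (cs) in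
theorem newRep_not_isReflectionRep (hr : 2 < r) : ¬ IsReflectionRep (newRep cs) := by
  intro h
  have hempty : {g | g ∈ (newRep cs).asGroupHom.range ∧ IsReflection g} = ∅ := by
    refine Set.eq_empty_of_forall_notMem ?_
    rintro _ ⟨⟨w, rfl⟩, -, hw⟩
    rw [Representation.asGroupHom_apply] at hw
    rcases Int.units_eq_one_or (permHom cs w).sign with hsign | hsign
    · exact finrank_range_newRep_sub_one_ne_one_of_even hsign hw
    · exact finrank_range_newRep_sub_one_ne_one_of_odd hr hsign hw
  rw [IsReflectionRep, hempty, Subgroup.closure_empty, eq_comm, MonoidHom.range_eq_bot_iff] at h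
  let s : Fin r := ⟨0, by lia⟩
  have hone : newRep cs (cs.simple s) = 1 := by
    rw [← Representation.asGroupHom_apply, h, MonoidHom.one_apply, Units.val_one]
  have hs : Fin.last r ≠ s.castSucc ∧ Fin.last r ≠ s.succ := by
    simp [Fin.ext_iff, s]; lia
  obtain ⟨x, hx⟩ := exists_coord_eq (y := Pi.single s.succ 1 - Pi.single (Fin.last r) 1) (by simp)
  have hfix := coord_newRep_simple cs s x (Fin.last r)
  rw [hone, Module.End.one_apply, Equiv.swap_apply_of_ne_of_ne hs.1 hs.2, hx] at hfix
  norm_num [hs.2] at hfix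

end Reflections

section Invariants

variable {r : ℕ}

/-- The coordinate `y_i` of `ℂ^{r+1}`, as a polynomial function on `ℂ ⊗ V`. -/
def coordFun (i : Fin (r + 1)) : polyFun (ℂ ⊗[ℂ] (Fin r → ℂ)) :=
  linearFun _ (LinearMap.proj i ∘ₗ coord r)

@[simp]
theorem coordFun_apply (i : Fin (r + 1)) (x : ℂ ⊗[ℂ] (Fin r → ℂ)) :
    (coordFun i : ℂ ⊗[ℂ] (Fin r → ℂ) → ℂ) x = coord r x i :=
  rfl

variable (r) in
/-- The third power sum of the coordinates. -/
def cubeSum : polyFun (ℂ ⊗[ℂ] (Fin r → ℂ)) :=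
  ∑ i, coordFun i ^ 3

theorem cubeSum_apply (x : ℂ ⊗[ℂ] (Fin r → ℂ)) :
    (cubeSum r : ℂ ⊗[ℂ] (Fin r → ℂ) → ℂ) x = ∑ i, coord r x i ^ 3 := by
  simp [cubeSum]

variable (r) in
/-- The Vandermonde product `∏_{i < j} (y_j ^ k - y_i ^ k)` of the `k`-th powers of the
coordinates. -/
def powVandermonde (k : ℕ) : polyFun (ℂ ⊗[ℂ] (Fin r → ℂ)) :=
  ∏ i, ∏ j ∈ Finset.Ioi i, (coordFun j ^ k - coordFun i ^ k)

theorem powVandermonde_apply (k : ℕ) (x : ℂ ⊗[ℂ] (Fin r → ℂ)) :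
    (powVandermonde r k : ℂ ⊗[ℂ] (Fin r → ℂ) → ℂ) x =
      ∏ i, ∏ j ∈ Finset.Ioi i, (coord r x j ^ k - coord r x i ^ k) := by
  simp [powVandermonde]

theorem exists_coord_comp_eq {n : ℕ} (e : Fin n ↪ Fin (r + 1)) {c : Fin n → ℂ}
    (hc : ∑ a, c a = 0) :
    ∃ x, (∀ a, coord r x (e a) = c a) ∧
      (cubeSum r : ℂ ⊗[ℂ] (Fin r → ℂ) → ℂ) x = ∑ a, c a ^ 3 := by
  let y : Fin (r + 1) → ℂ := Function.extend e c 0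
  have hy : ∀ a, y (e a) = c a := e.injective.extend_apply c 0
  have hy₀ : ∀ i ∉ Set.range e, y i = 0 := fun i hi =>
    Function.extend_apply' c (0 : Fin (r + 1) → ℂ) i hi
  obtain ⟨x, hx⟩ := exists_coord_eq (y := y) (by
    rw [← hc, Fintype.sum_of_injective e e.injective c y hy₀ fun a => (hy a).symm])
  refine ⟨x, fun a => by rw [hx, hy], ?_⟩
  rw [cubeSum_apply, hx]
  exact (Fintype.sum_of_injective e e.injective _ _
    (fun i hi => by rw [hy₀ i hi, zero_pow three_ne_zero])
    fun a => by rw [hy]).symm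

theorem cubeSum_ne_zero (hr : 1 < r) : cubeSum r ≠ 0 := by
  obtain ⟨x, -, hx⟩ := exists_coord_comp_eq (Fin.castLEEmb (Nat.succ_lt_succ hr))
    (c := ![1, 1, -2]) (by norm_num [Fin.sum_univ_succ])
  intro h
  norm_num [h, Fin.sum_univ_succ] at hx

theorem isRelPrime_coordFun_sub_cubeSum (hr : 1 < r) {i j : Fin (r + 1)} (hij : i ≠ j) :
    IsRelPrime (coordFun j - coordFun i) (cubeSum r) := by
  obtain ⟨e, rfl, rfl⟩ : ∃ e : Fin 3 ↪ Fin (r + 1), e 0 = i ∧ e 1 = j :=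
    exists_embedding_zero_one (by rw [Nat.card_fin]; lia) hij
  obtain ⟨x, hx, -⟩ := exists_coord_comp_eq e (c := ![1, -1, 0]) (by simp [Fin.sum_univ_succ])
  obtain ⟨y, hy, hy₃⟩ := exists_coord_comp_eq e (c := ![1, 1, -2])
    (by norm_num [Fin.sum_univ_succ])
  rw [coordFun, coordFun, ← map_sub]
  refine isRelPrime_linearFun (v := y) (fun h => ?_) (by simp [hy]) ?_
  · have := LinearMap.congr_fun h x
    norm_num [hx] at this
  · norm_num [hy₃, Fin.sum_univ_succ]

theorem isRelPrime_coordFun_add_cubeSum (hr : 3 < r) {i j : Fin (r + 1)} (hij : i ≠ j) :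
    IsRelPrime (coordFun j + coordFun i) (cubeSum r) := by
  obtain ⟨e, rfl, rfl⟩ : ∃ e : Fin 5 ↪ Fin (r + 1), e 0 = i ∧ e 1 = j :=
    exists_embedding_zero_one (by rw [Nat.card_fin]; lia) hij
  obtain ⟨x, hx, -⟩ := exists_coord_comp_eq e (c := ![1, 0, -1, 0, 0]) (by simp [Fin.sum_univ_succ])
  obtain ⟨y, hy, hy₃⟩ := exists_coord_comp_eq e (c := ![1, -1, 2, -1, -1])
    (by norm_num [Fin.sum_univ_succ])
  rw [coordFun, coordFun, ← map_add]
  refine isRelPrime_linearFun (v := y) (fun h => ?_) (by simp [hy]) ?_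
  · have := LinearMap.congr_fun h x
    norm_num [hx] at this
  · norm_num [hy₃, Fin.sum_univ_succ]

theorem isRelPrime_powVandermonde_one_cubeSum (hr : 1 < r) :
    IsRelPrime (powVandermonde r 1) (cubeSum r) := by
  refine IsRelPrime.prod_left fun i _ => IsRelPrime.prod_left fun j hj => ?_
  rw [pow_one, pow_one]
  exact isRelPrime_coordFun_sub_cubeSum hr (Finset.mem_Ioi.mp hj).ne

theorem isRelPrime_powVandermonde_two_cubeSum (hr : 3 < r) :
    IsRelPrime (powVandermonde r 2) (cubeSum r) := by
  refine IsRelPrime.prod_left fun i _ => IsRelPrime.prod_left fun j hj => ?_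
  have hij := (Finset.mem_Ioi.mp hj).ne
  rw [sq_sub_sq]
  exact (isRelPrime_coordFun_add_cubeSum hr hij).mul_left
    (isRelPrime_coordFun_sub_cubeSum (by lia) hij)

variable {W : Type*} [Group W] (cs : CoxeterSystem (CoxeterMatrix.A r) W)

theorem sign_comp_permHom_ne_one (hr : 0 < r) : Equiv.Perm.sign.comp (permHom cs) ≠ 1 := by
  intro h
  have hs := DFunLike.congr_fun h (cs.simple ⟨0, hr⟩)
  rw [MonoidHom.comp_apply, permHom_simple, Equiv.Perm.sign_swap Fin.castSucc_lt_succ.ne,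
    MonoidHom.one_apply] at hs
  exact absurd hs (by decide)

theorem isSemiInvariant_cubeSum :
    IsSemiInvariant (newRep cs) (Equiv.Perm.sign.comp (permHom cs)) (cubeSum r) := by
  intro w x
  simp only [cubeSum_apply, coord_newRep, smul_pow, ← Finset.smul_sum]
  rw [Equiv.sum_comp (permHom cs w)⁻¹ fun i => coord r x i ^ 3, Int.units_pow_eq_pow_mod_two,
    show 3 % 2 = 1 from rfl, pow_one, MonoidHom.comp_apply]

theorem isSemiInvariant_powVandermonde {k : ℕ} (hk : Even (k * (r + 1).choose 2)) :
    IsSemiInvariant (newRep cs) (Equiv.Perm.sign.comp (permHom cs)) (powVandermonde r k) := by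
  intro w x
  have hsign : ((permHom cs w).sign ^ k) ^ (r + 1).choose 2 = 1 := by
    rw [← pow_mul, Int.units_pow_eq_pow_mod_two, Nat.even_iff.mp hk, pow_zero]
  simp only [powVandermonde_apply, coord_newRep, smul_pow, ← smul_sub, Finset.prod_smul]
  rw [prod_prod_Ioi_const, hsign, one_smul,
    prod_prod_Ioi_sub_comp_perm (fun i => coord r x i ^ k) (permHom cs w)⁻¹,
    Equiv.Perm.sign_inv, MonoidHom.comp_apply, Units.smul_def, zsmul_eq_mul]

-- For `r = 3` the squares do not work: `y_i + y_j` divides `∑ y_i³`.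
theorem exists_isSemiInvariant_isRelPrime_cubeSum (hr : 2 < r) :
    ∃ h : polyFun (ℂ ⊗[ℂ] (Fin r → ℂ)),
      IsSemiInvariant (newRep cs) (Equiv.Perm.sign.comp (permHom cs)) h ∧
        IsRelPrime (cubeSum r) h := by
  obtain rfl | hr : r = 3 ∨ 3 < r := by lia
  · exact ⟨powVandermonde 3 1, isSemiInvariant_powVandermonde cs (by decide),
      (isRelPrime_powVandermonde_one_cubeSum (by decide)).symm⟩
  · exact ⟨powVandermonde r 2, isSemiInvariant_powVandermonde cs (even_two_mul _),
      (isRelPrime_powVandermonde_two_cubeSum hr).symm⟩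

theorem not_isPolynomialRing_invariantRing_newRep (hr : 2 < r) :
    ¬ IsPolynomialRing (invariantRing (newRep cs)) := by
  obtain ⟨h, hh, hrel⟩ := exists_isSemiInvariant_isRelPrime_cubeSum cs hr
  exact not_isPolynomialRing_of_isSemiInvariant (sign_comp_permHom_ne_one cs (by lia))
    (cubeSum_ne_zero (by lia)) (isSemiInvariant_cubeSum cs) hh hrel

end Invariants

end CoxeterRep

end

theorem mainTheorem4 {r : ℕ} (hr : 2 < r) {W : Type*} [Group W]
    (cs : CoxeterSystem (CoxeterMatrix.A r) W) :
    (CoxeterRep.newRep cs).IsIrreducible ∧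
      ¬ CoxeterRep.IsReflectionRep (CoxeterRep.newRep cs) ∧
      ¬ CoxeterRep.IsPolynomialRing (CoxeterRep.invariantRing (CoxeterRep.newRep cs)) :=
  ⟨CoxeterRep.newRep_isIrreducible cs (by lia), CoxeterRep.newRep_not_isReflectionRep cs hr,
    CoxeterRep.not_isPolynomialRing_invariantRing_newRep cs hr⟩
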